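/- Let $n,d\ge 1$. Consider $n$ agents with positions $x_1(t),\dots,x_n(t)\in\mathbb{R}^d$ at the end of round $t$. In each round $t\ge1$, agents communicate along a directed graph $G_t$ on $\{1,\dots,n\}$, chosen arbitrarily in a fixed non-empty set $\mathcal N$ (the network model) of directed graphs that have a self-loop at every node. The model is rooted if every graph in $\mathcal N$ has a node from which every node can be reached by a directed path. In the Amortized Centroid algorithm, agent $p$ starts with an arbitrary initial position $x_p=x_p(0)$ and the set $C_p=\{x_p\}$. In every round $t\ge 1$, $p$ receives the sets $C_q$ from all its in-neighbors $q$ in $G_t$ and replaces $C_p$ by $C_p\cup\bigcup_q C_q$. If moreover $t\equiv 0 \pmod{n-1}$, then $p$ sets $x_p$ to the centroid of the convex hull of $C_p$ (uniform mass distribution over the hull, in the dimension of its affine hull), and then sets $C_p=\{x_p\}$. Theorem. In any rooted network model $\mathcal N$, the Amortized Centroid algorithm solves asymptotic consensus: for all initial positions and all sequences $G_1,G_2,\dots$ in $\mathcal N$, every sequence $x_p(t)$ converges, all of them have the same limit, and this limit lies in the convex hull of the initial positions. Its convergence rate, i.e. the supremum over all initial positions and all sequences of graphs in $\mathcal N$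 of $\max_p\limsup_{t\to\infty}\|x_p(t)-\lim_{s\to\infty} x_p(s)\|^{1/t}$, is at most $1-\frac{1}{n(d+1)}$. For its convergence time, let $\delta_k(t)=\max_p x_{p,k}(t)-\min_p x_{p,k}(t)$ be the spread of the $k$-th components and $\delta(0)=\max_k\delta_k(0)$. For every execution and every $\varepsilon>0$, $$T(\varepsilon)=\max_{1\le k\le d}\inf\{\tau\in\mathbb{N}:\forall t\ge\tau,\ \delta_k(t)\le\varepsilon\}\ \le\ (n-1)\max\Big\{0,\Big\lceil\log_{(d+1)/d}\frac{\delta(0)}{\varepsilon}\Big\rceil\Big\},$$ where the right-hand side is read as $0$ if $\delta(0)=0$; and, relative to the initial spreads, $$\max_{1\le k\le d}\inf\{\tau\in\mathbb{N}:\forall t\ge\tau,\ \delta_k(t)\le\varepsilon\,\delta_k(0)\}\ \le\ (n-1)\max\Big\{0,\Big\lceil\log_{(d+1)/d}\frac{1}{\varepsilon}\Big\rceil\Big\}.$$ -/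

import Mathlib

open Filter Topology MeasureTheory
open scoped ENNReal

namespace AsymptoticConsensus

/-- Euclidean `d`-space, in which agents have their positions. -/
abbrev Pos (d : ℕ) : Type := EuclideanSpace ℝ (Fin d)

/-- A network model on `n` agents: a non-empty set of directed communication graphs,
each of which has a self-loop at every node. -/
structure NetworkModel (n : ℕ) where
  graphs : Set (Digraph (Fin n))
  nonempty : graphs.Nonempty
  selfLoop : ∀ G ∈ graphs, ∀ p, G.Adj p p

/-- A directed graph is rooted (has a rooted spanning tree) if some node, the root, has a
directed path to every node. -/
def IsRootedGraph {V : Type*} (G : Digraph V) : Prop :=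
  ∃ r, ∀ q, Relation.ReflTransGen G.Adj r q

/-- A network model is rooted if all its graphs are rooted. -/
def NetworkModel.IsRooted {n : ℕ} (N : NetworkModel n) : Prop :=
  ∀ G ∈ N.graphs, IsRootedGraph G

/-- A communication pattern in `N`; `G t` is the communication graph of round `t`.  Rounds are
numbered from `1`, so `G 0` plays no role. -/
def NetworkModel.IsPattern {n : ℕ} (N : NetworkModel n) (G : ℕ → Digraph (Fin n)) : Prop :=
  ∀ t, G t ∈ N.graphs

/-- A deterministic round-based algorithm for `n` agents in Euclidean `d`-space.
`step p t s msgs` is the state of agent `p` at the end of round `t`, if it was `s` before, and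
`msgs` is the set of pairs (sender, state of the sender) that `p` receives in round `t`. -/
structure Algorithm (n d : ℕ) where
  State : Type
  init : Pos d → State
  step : Fin n → ℕ → State → Set (Fin n × State) → State
  pos : State → Pos d

namespace Algorithm

variable {n d : ℕ}

/-- The state of every agent at the end of round `t`, in the execution with initial positions
`x₀` and communication pattern `G`. -/
def run (A : Algorithm n d) (x₀ : Fin n → Pos d) (G : ℕ → Digraph (Fin n)) :
    ℕ → Fin n → A.State
  | 0 => fun p => A.init (x₀ p)
  | t + 1 => fun p =>
      A.step p (t + 1) (A.run x₀ G t p) {m | (G (t + 1)).Adj m.1 p ∧ m.2 = A.run x₀ G t m.1}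

/-- `A.x x₀ G t p` is the position `x_p(t)`. -/
def x (A : Algorithm n d) (x₀ : Fin n → Pos d) (G : ℕ → Digraph (Fin n)) (t : ℕ) (p : Fin n) :
    Pos d :=
  A.pos (A.run x₀ G t p)

/-- The algorithm solves asymptotic consensus in `N`: convergence, agreement and validity hold in
every execution with a communication pattern in `N`. -/
def SolvesAsymptoticConsensus (A : Algorithm n d) (N : NetworkModel n) : Prop :=
  ∀ (x₀ : Fin n → Pos d) (G : ℕ → Digraph (Fin n)), N.IsPattern G →
    (∀ p, ∃ l, Tendsto (fun t => A.x x₀ G t p) atTop (𝓝 l)) ∧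
    (∀ p q l l', Tendsto (fun t => A.x x₀ G t p) atTop (𝓝 l) →
      Tendsto (fun t => A.x x₀ G t q) atTop (𝓝 l') → l = l') ∧
    (∀ p l, Tendsto (fun t => A.x x₀ G t p) atTop (𝓝 l) → l ∈ convexHull ℝ (Set.range x₀))

/-- The convergence rate of `A` in `N`: the supremum, over all initial configurations and all
communication patterns in `N`, of `max_p limsup_t ‖x_p(t) - x_p^*‖ ^ (1/t)`, where `x_p^*` is the
limit of `x_p(t)`. -/
noncomputable def convergenceRate (A : Algorithm n d) (N : NetworkModel n) : ℝ≥0∞ :=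
  ⨆ (x₀ : Fin n → Pos d) (G : ℕ → Digraph (Fin n)) (_ : N.IsPattern G) (l : Fin n → Pos d)
    (_ : ∀ p, Tendsto (fun t => A.x x₀ G t p) atTop (𝓝 (l p))),
    ⨆ p, limsup (fun t : ℕ => ‖A.x x₀ G t p - l p‖ₑ ^ (1 / (t : ℝ))) atTop

end Algorithm

variable {n d : ℕ}

/-- The seminorm `max_p u_p - min_p u_p`, applied to the `k`-th components of the positions in a
configuration. -/
noncomputable def spread (y : Fin n → Pos d) (k : Fin d) : ℝ :=
  (⨆ p, y p k) - (⨅ p, y p k)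

/-- The convergence time with precision `ε` of a sequence of configurations: the maximum over the
components `k` of the least `τ` such that the spread of the `k`-th components is at most `ε` from
time `τ` on (`⊤` if there is no such `τ`). -/
noncomputable def convergenceTime (x : ℕ → Fin n → Pos d) (ε : ℝ) : ℕ∞ :=
  ⨆ k : Fin d, ⨅ (τ : ℕ) (_ : ∀ t ≥ τ, spread (x t) k ≤ ε), (τ : ℕ∞)

/-- The convergence time with precision `ε` relative to the initial spreads. -/
noncomputable def relConvergenceTime (x : ℕ → Fin n → Pos d) (ε : ℝ) : ℕ∞ :=
  ⨆ k : Fin d, ⨅ (τ : ℕ) (_ : ∀ t ≥ τ, spread (x t) k ≤ ε * spread (x 0) k), (τ : ℕ∞)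

/-- The centroid of `K` with uniform mass distribution over `K`.  If the affine hull of `K` has
dimension `k`, the mass distribution is the `k`-dimensional Hausdorff measure restricted to `K`,
which on this affine hull is a constant multiple of the `k`-dimensional volume. -/
noncomputable def centroid (K : Set (Pos d)) : Pos d :=
  ⨍ y in K, y ∂(Measure.hausdorffMeasure (Module.finrank ℝ (vectorSpan ℝ K) : ℝ))

open Classical in
/-- The Amortized Centroid algorithm.  The state of agent `p` is the pair `(x_p, C_p)` of its
position and the set of the positions gathered so far. -/
noncomputable def amortizedCentroid (n d : ℕ) : Algorithm n d where
  State := Pos d × Set (Pos d)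
  init y := (y, {y})
  step _ t s msgs :=
    let C := s.2 ∪ ⋃ m ∈ msgs, m.2.2
    if t ≡ 0 [MOD (n - 1)] then
      (centroid (convexHull ℝ C), {centroid (convexHull ℝ C)})
    else (s.1, C)
  pos s := s.1

end AsymptoticConsensus

/-!
Let `c = d / (d + 1)`.  Everything follows from the fact that, in every `n - 1` rounds between two
resets of the gathered sets, the hull of the positions shrinks to a subset in which the spread of
each component is smaller by the factor `c`.

Two observations give this contraction.  The composition of `n - 1` rooted graphs with self-loops
is non-split: going back in time from two agents, the sets of agents that influence them gain a
node in every round until they meet (`exists_inter_nonempty_of_card_lt`).  Hence any two gathered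
sets share a point `z` at the moment of a reset.  Moreover, the centroid of a compact convex set
in dimension at most `d` satisfies Minkowski's bound (`map_centroid_sub_le`): if a linear
functional `l` is at most `M` on the set, then `l` exceeds `l z` at the centroid by at most
`c * (M - l z)`.  Applied to a component and to its negative, at a common point `z`, this bounds
the distance between the components of any two new positions (`spread_centroid_le`).

Minkowski's bound is proved without polar coordinates: the integral of `M - l` over the image of
the set under the homothety with center `z` and ratio `r < 1` is at most the integral over the set
itself.  The scaling of Hausdorff measure turns this into an inequality between polynomials in
`r`, which is divided by `1 - r` before `r` tends to `1`.

The hulls of the positions at the resets are nested compact sets, and a point in their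
intersection is the common limit (`exists_abs_x_sub_le`).  Since `n ⌊t / n⌋ ≤ t`, the distance to
it is at most a constant times `c ^ ⌊t / n⌋`, so that the rate is at most `c ^ (1 / n)`, which
Bernoulli's inequality bounds by `1 - 1 / (n (d + 1))`.

For `n = 1`, rounds are counted modulo `n - 1 = 0`, so that the only agent never moves; spreads
vanish, and the same estimates hold trivially.
-/

namespace AsymptoticConsensus

/-! ### Compositions of rooted graphs -/

/-- In a graph with self-loops and root `r`, a non-empty set of nodes that misses `r` is strictly
smaller than its set of in-neighbors, since a path from `r` has to enter it. -/
theorem exists_adj_notMem_of_root_notMem {V : Type*} {G : Digraph V} {r : V}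
    (hr : ∀ q, Relation.ReflTransGen G.Adj r q) {A : Finset V} (hA : A.Nonempty) (hrA : r ∉ A) :
    ∃ u ∉ A, ∃ a ∈ A, G.Adj u a := by
  by_contra! h
  obtain ⟨a, ha⟩ := hA
  refine hrA ?_
  have key : ∀ x, Relation.ReflTransGen G.Adj r x → x ∈ A → r ∈ A := by
    intro x hx
    induction hx with
    | refl => exact id
    | tail _ hbc ih =>
      intro hc
      by_contra hrA
      exact h _ (fun hb => hrA (ih hb)) _ hc hbc
  exact key a (hr a) ha

theorem exists_card_add_lt_card_inNeighbors {n : ℕ} {G : Digraph (Fin n)}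
    (hG : IsRootedGraph G) (hself : ∀ p, G.Adj p p) {A B : Finset (Fin n)} (hA : A.Nonempty)
    (hB : B.Nonempty) (hAB : Disjoint A B) :
    ∃ A' B' : Finset (Fin n), A.card + B.card < A'.card + B'.card ∧ A'.Nonempty ∧ B'.Nonempty ∧
      (∀ u ∈ A', ∃ a ∈ A, G.Adj u a) ∧ ∀ u ∈ B', ∃ b ∈ B, G.Adj u b := by
  obtain ⟨r, hr⟩ := hG
  rcases Classical.em (r ∈ A) with h | h
  · have hrB : r ∉ B := fun h' => Finset.disjoint_left.1 hAB h h'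
    obtain ⟨u, hu, b, hb, hub⟩ := exists_adj_notMem_of_root_notMem hr hB hrB
    refine ⟨A, insert u B, ?_, hA, Finset.insert_nonempty _ _, fun a ha => ⟨a, ha, hself a⟩, ?_⟩
    · rw [Finset.card_insert_of_notMem hu]; omega
    · intro v hv
      rcases Finset.mem_insert.1 hv with rfl | hv
      exacts [⟨b, hb, hub⟩, ⟨v, hv, hself v⟩]
  · obtain ⟨u, hu, b, hb, hub⟩ := exists_adj_notMem_of_root_notMem hr hA h
    refine ⟨insert u A, B, ?_, Finset.insert_nonempty _ _, hB, ?_, fun a ha => ⟨a, ha, hself a⟩⟩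
    · rw [Finset.card_insert_of_notMem hu]; omega
    · intro v hv
      rcases Finset.mem_insert.1 hv with rfl | hv
      exacts [⟨b, hb, hub⟩, ⟨v, hv, hself v⟩]

/-- If sets `C i p` of gathered values are passed along rooted graphs with self-loops, then some
member of `A` and some member of `B` share a value as soon as `|A| + |B| + i > n`.  Going back one
round replaces `A` and `B`, if they are disjoint, by sets of in-neighbors of larger total size. -/
theorem exists_inter_nonempty_of_card_lt {n : ℕ} {α : Type*} (H : ℕ → Digraph (Fin n))
    (hroot : ∀ i, IsRootedGraph (H i)) (hself : ∀ i p, (H i).Adj p p)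
    (C : ℕ → Fin n → Set α) (hC0 : ∀ p, (C 0 p).Nonempty)
    (hC : ∀ i p q, (H i).Adj q p → C i q ⊆ C (i + 1) p) (i : ℕ) :
    ∀ A B : Finset (Fin n), A.Nonempty → B.Nonempty → n < A.card + B.card + i →
      ∃ a ∈ A, ∃ b ∈ B, (C i a ∩ C i b).Nonempty := by
  have hne : ∀ i p, (C i p).Nonempty := by
    intro i
    induction i with
    | zero => exact hC0
    | succ i ih => exact fun p => (ih p).mono (hC i p p (hself i p))
  induction i with
  | zero =>
    intro A B _ _ h
    have hAB : ¬ Disjoint A B := by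
      intro hAB
      have := Finset.card_le_univ (A.disjUnion B hAB)
      rw [Finset.card_disjUnion, Fintype.card_fin] at this
      omega
    obtain ⟨a, ha, hb⟩ := Finset.not_disjoint_iff.1 hAB
    exact ⟨a, ha, a, hb, by simpa using hC0 a⟩
  | succ i ih =>
    intro A B hA hB h
    by_cases hAB : Disjoint A B
    · obtain ⟨A', B', hc, hA', hB', h1, h2⟩ :=
        exists_card_add_lt_card_inNeighbors (hroot i) (hself i) hA hB hAB
      obtain ⟨a', ha', b', hb', hab⟩ := ih A' B' hA' hB' (by omega)
      obtain ⟨a, ha, haa⟩ := h1 a' ha'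
      obtain ⟨b, hb, hbb⟩ := h2 b' hb'
      exact ⟨a, ha, b, hb, hab.mono (Set.inter_subset_inter (hC i a a' haa) (hC i b b' hbb))⟩
    · obtain ⟨a, ha, hb⟩ := Finset.not_disjoint_iff.1 hAB
      exact ⟨a, ha, a, hb, by simpa using hne (i + 1) a⟩

/-! ### The centroid of a compact convex set -/

section Hausdorff

variable {E : Type*} [NormedAddCommGroup E] [NormedSpace ℝ E] [FiniteDimensional ℝ E]
  [MeasurableSpace E] [BorelSpace E]

/-- In its own dimension, a compact convex set has positive and finite Hausdorff measure: this
measure is a Haar measure on the direction of the affine span. -/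
theorem hausdorffMeasure_ne_zero_and_ne_top {K : Set E} (hK : Convex ℝ K) (hKc : IsCompact K)
    (hne : K.Nonempty) :
    (Measure.hausdorffMeasure (Module.finrank ℝ (vectorSpan ℝ K) : ℝ) : Measure E) K ≠ 0 ∧
    (Measure.hausdorffMeasure (Module.finrank ℝ (vectorSpan ℝ K) : ℝ) : Measure E) K ≠ ∞ := by
  obtain ⟨z, hz⟩ := hne
  rw [← direction_affineSpan]
  set V := (affineSpan ℝ K).direction with hV
  have hzS : z ∈ affineSpan ℝ K := subset_affineSpan ℝ K hz
  let z' : affineSpan ℝ K := ⟨z, hzS⟩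
  have : Nonempty (affineSpan ℝ K) := ⟨z'⟩
  let e : V ≃ᵢ affineSpan ℝ K := IsometryEquiv.vaddConst z'
  let g : V → E := fun v => (e v : E)
  have hg : Isometry g := isometry_subtype_coe.comp e.isometry
  have hrange : Set.range g = affineSpan ℝ K := by
    ext y
    constructor
    · rintro ⟨v, rfl⟩
      exact (e v).2
    · intro hy
      exact ⟨e.symm ⟨y, hy⟩, by simp [g]⟩
  have hμ : (Measure.hausdorffMeasure (Module.finrank ℝ V : ℝ) : Measure E) K =
      (Measure.hausdorffMeasure (Module.finrank ℝ V : ℝ) : Measure V) (g ⁻¹' K) := by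
    rw [hg.hausdorffMeasure_preimage (Or.inl (Nat.cast_nonneg _)), hrange,
      Set.inter_eq_self_of_subset_left (subset_affineSpan ℝ K)]
  rw [hμ]
  constructor
  · obtain ⟨y, hy⟩ := Set.Nonempty.intrinsicInterior hK ⟨z, hz⟩
    obtain ⟨y', hy', -⟩ := hy
    have hint : (interior (g ⁻¹' K)).Nonempty := by
      have h1 : e ⁻¹' interior ((↑) ⁻¹' K : Set (affineSpan ℝ K)) ⊆ interior (g ⁻¹' K) :=
        preimage_interior_subset_interior_preimage e.continuous
      exact ⟨e.symm y', h1 (by simpa using hy')⟩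
    exact (Measure.measure_pos_of_nonempty_interior _ hint).ne'
  · have hgc : IsCompact (g ⁻¹' K) :=
      hg.isClosedEmbedding.isCompact_preimage hKc
    exact hgc.measure_lt_top.ne

theorem integrableOn_hausdorffMeasure {F : Type*} [NormedAddCommGroup F]
    {K : Set E} (hK : Convex ℝ K) (hKc : IsCompact K)
    (hne : K.Nonempty) {f : E → F} [SecondCountableTopology F] [MeasurableSpace F] [BorelSpace F]
    (hf : Continuous f) :
    IntegrableOn f K (Measure.hausdorffMeasure (Module.finrank ℝ (vectorSpan ℝ K) : ℝ)) := by
  obtain ⟨M, hM⟩ := (hKc.image hf).isBounded.exists_norm_le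
  refine Measure.integrableOn_of_bounded (hausdorffMeasure_ne_zero_and_ne_top hK hKc hne).2
    hf.measurable.aestronglyMeasurable (M := M) ?_
  exact (ae_restrict_iff' hKc.measurableSet).2
    (.of_forall fun y hy => hM _ (Set.mem_image_of_mem f hy))

/-- Change of variables by a homothety for the `k`-dimensional Hausdorff measure. -/
theorem setIntegral_homothety_image {k : ℕ} (z : E) {r : ℝ} (hr : 0 < r)
    (K : Set E) (f : E → ℝ) :
    ∫ y in AffineMap.homothety z r '' K, f y ∂(Measure.hausdorffMeasure (k : ℝ)) =
      r ^ k * ∫ y in K, f (AffineMap.homothety z r y) ∂(Measure.hausdorffMeasure (k : ℝ)) := by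
  let u : ℝˣ := Units.mk0 r hr.ne'
  have hcoe : ⇑(AffineEquiv.homothetyUnitsMulHom z u) = AffineMap.homothety z r := rfl
  have hinj : Function.Injective (AffineMap.homothety z r : E → E) := by
    rw [← hcoe]; exact AffineEquiv.injective _
  have hemb : MeasurableEmbedding (AffineMap.homothety z r : E → E) :=
    (AffineMap.homothety_continuous z r).measurableEmbedding hinj
  have h := hemb.setIntegral_map (μ := Measure.hausdorffMeasure (k : ℝ)) f
    (AffineMap.homothety z r '' K)
  rw [Set.preimage_image_eq _ hinj, map_homothety_hausdorffMeasure (Nat.cast_nonneg k) z hr.ne',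
    Measure.restrict_smul, integral_smul_nnreal_measure, NNReal.rpow_natCast, NNReal.smul_def,
    NNReal.coe_pow, NNReal.coe_inv, coe_nnnorm, Real.norm_of_nonneg hr.le, smul_eq_mul] at h
  rw [← h, ← mul_assoc, ← mul_pow, mul_inv_cancel₀ hr.ne', one_pow, one_mul]

/-- Division by `1 - r` and the limit `r → 1` turn `1 - r ^ (k + 1)` and `1 - r ^ k` into `k + 1`
and `k`. -/
theorem succ_mul_le_mul_of_forall_pow {k : ℕ} {a b : ℝ}
    (h : ∀ r : ℝ, 0 < r → r < 1 → (1 - r ^ (k + 1)) * a ≤ (1 - r ^ k) * b) :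
    ((k : ℝ) + 1) * a ≤ k * b := by
  have hgeom : ∀ m : ℕ, Tendsto (fun r : ℝ => ∑ i ∈ Finset.range m, r ^ i) (𝓝[<] 1) (𝓝 m) := by
    intro m
    have hc : Continuous fun r : ℝ => ∑ i ∈ Finset.range m, r ^ i := by fun_prop
    simpa using (hc.tendsto 1).mono_left nhdsWithin_le_nhds
  have h1 := (hgeom (k + 1)).mul_const a
  have h2 := (hgeom k).mul_const b
  push_cast at h1
  refine le_of_tendsto_of_tendsto h1 h2 ?_
  filter_upwards [Ioo_mem_nhdsLT (zero_lt_one' ℝ)] with r hr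
  have hr' := h r hr.1 hr.2
  rw [← mul_neg_geom_sum, ← mul_neg_geom_sum, mul_assoc, mul_assoc] at hr'
  exact le_of_mul_le_mul_left hr' (sub_pos.2 hr.2)

/-- For an affine function that is at most `b` on `K` and vanishes at `z ∈ K`, the mean over `K` is
at most `k / (k + 1) * b`, where `k` is the dimension of `K`.  For `0 < r < 1`, the homothetic copy of `K` with center `z` and ratio
`r` lies in `K`; comparing the integrals of `b - f` over both, and letting `r` tend to `1`, gives
the claim. -/
theorem succ_mul_setIntegral_le {K : Set E} (hK : Convex ℝ K) (hKc : IsCompact K)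
    {z : E} (hz : z ∈ K) (l : E →L[ℝ] ℝ) {b : ℝ} (hb : ∀ y ∈ K, l y - l z ≤ b) {k : ℕ}
    (hk : k = Module.finrank ℝ (vectorSpan ℝ K)) :
    ((k : ℝ) + 1) * ∫ y in K, (l y - l z) ∂(Measure.hausdorffMeasure (k : ℝ)) ≤
      k * (b * (Measure.hausdorffMeasure (k : ℝ) : Measure E).real K) := by
  have hint : ∀ f : E → ℝ, Continuous f →
      IntegrableOn f K (Measure.hausdorffMeasure (k : ℝ)) := fun f hf => by
    subst hk; exact integrableOn_hausdorffMeasure hK hKc ⟨z, hz⟩ hf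
  set μ : Measure E := Measure.hausdorffMeasure (k : ℝ) with hμ
  have hval : ∀ c : ℝ, ∫ y in K, (b - c * (l y - l z)) ∂μ =
      b * μ.real K - c * ∫ y in K, (l y - l z) ∂μ := by
    intro c
    rw [integral_sub (hint _ (by fun_prop)) (hint _ (by fun_prop)), integral_const_mul,
      setIntegral_const, smul_eq_mul, mul_comm b]
  refine succ_mul_le_mul_of_forall_pow fun r hr0 hr1 => ?_
  have hsub : AffineMap.homothety z r '' K ⊆ K := by
    rintro _ ⟨y, hy, rfl⟩
    rw [AffineMap.homothety_eq_lineMap]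
    exact hK.lineMap_mem hz hy ⟨hr0.le, hr1.le⟩
  have hle : ∫ y in AffineMap.homothety z r '' K, (b - 1 * (l y - l z)) ∂μ ≤
      ∫ y in K, (b - 1 * (l y - l z)) ∂μ := by
    refine setIntegral_mono_set (hint _ (by fun_prop)) ?_ (.of_forall hsub)
    refine (ae_restrict_iff' hKc.measurableSet).2 (.of_forall fun y hy => ?_)
    simpa using hb y hy
  rw [hμ, setIntegral_homothety_image z hr0, ← hμ, hval] at hle
  have hcomp : ∀ y, b - 1 * (l (AffineMap.homothety z r y) - l z) = b - r * (l y - l z) := by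
    intro y
    simp [AffineMap.homothety_apply]
  simp_rw [hcomp] at hle
  rw [hval] at hle
  linear_combination hle

end Hausdorff

variable {d : ℕ}

theorem centroid_mem {K : Set (Pos d)} (hK : Convex ℝ K) (hKc : IsCompact K) (hne : K.Nonempty) :
    centroid K ∈ K := by
  obtain ⟨h0, htop⟩ := hausdorffMeasure_ne_zero_and_ne_top hK hKc hne
  exact hK.set_average_mem hKc.isClosed h0 htop
    ((ae_restrict_iff' hKc.measurableSet).2 (.of_forall fun _ hy => hy))
    (integrableOn_hausdorffMeasure hK hKc hne continuous_id)

/-- Minkowski's bound on the asymmetry of a convex body about its centroid: a linear functional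
exceeds its value at any point `z` of the body by at most the fraction `d / (d + 1)` of the
maximal possible amount. -/
theorem map_centroid_sub_le {K : Set (Pos d)} (hK : Convex ℝ K) (hKc : IsCompact K)
    {z : Pos d} (hz : z ∈ K) (l : Pos d →L[ℝ] ℝ) {M : ℝ} (hM : ∀ y ∈ K, l y ≤ M) :
    l (centroid K) - l z ≤ (d : ℝ) / (d + 1) * (M - l z) := by
  obtain ⟨h0, htop⟩ := hausdorffMeasure_ne_zero_and_ne_top hK hKc ⟨z, hz⟩
  have hint := succ_mul_setIntegral_le hK hKc hz l (b := M - l z)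
    (fun y hy => sub_le_sub_right (hM y hy) _) rfl
  have hkd : Module.finrank ℝ (vectorSpan ℝ K) ≤ d := by
    simpa using Submodule.finrank_le (vectorSpan ℝ K)
  have hl : l (centroid K) = ⨍ y in K, l y
      ∂(Measure.hausdorffMeasure (Module.finrank ℝ (vectorSpan ℝ K) : ℝ)) := by
    rw [centroid, setAverage_eq, setAverage_eq, map_smul,
      l.integral_comp_comm (integrableOn_hausdorffMeasure hK hKc ⟨z, hz⟩ continuous_id')]
  have hintl := integrableOn_hausdorffMeasure hK hKc ⟨z, hz⟩ l.continuous
  set k := Module.finrank ℝ (vectorSpan ℝ K)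
  set μ : Measure (Pos d) := Measure.hausdorffMeasure (k : ℝ)
  have hN : 0 < μ.real K := ENNReal.toReal_pos h0 htop
  have hL : ∫ y in K, (l y - l z) ∂μ = μ.real K * (l (centroid K) - l z) := by
    rw [integral_sub hintl (integrableOn_const htop), setIntegral_const, hl, setAverage_eq,
      smul_eq_mul, smul_eq_mul, mul_sub, mul_inv_cancel_left₀ hN.ne']
  rw [hL] at hint
  have hk : ((k : ℝ) + 1) * (l (centroid K) - l z) ≤ k * (M - l z) := by
    refine le_of_mul_le_mul_left ?_ hN
    linear_combination hint
  have hMz : 0 ≤ M - l z := sub_nonneg.2 (hM z hz)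
  have hkd' : (k : ℝ) ≤ d := by exact_mod_cast hkd
  rw [← mul_div_right_comm, le_div_iff₀ (by positivity), mul_comm]
  refine le_of_mul_le_mul_left ?_ (by positivity : 0 < (k : ℝ) + 1)
  nlinarith [mul_le_mul_of_nonneg_left hk (by positivity : 0 ≤ (d : ℝ) + 1)]

variable {n : ℕ}

/-! ### Spreads of configurations -/

theorem apply_sub_apply_le_spread (y : Fin n → Pos d) (k : Fin d) (p q : Fin n) :
    y p k - y q k ≤ spread y k :=
  sub_le_sub (le_ciSup (Set.finite_range fun p => y p k).bddAbove p)
    (ciInf_le (Set.finite_range fun p => y p k).bddBelow q)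

theorem spread_le [Nonempty (Fin n)] {y : Fin n → Pos d} {k : Fin d} {b : ℝ}
    (h : ∀ p q, y p k - y q k ≤ b) : spread y k ≤ b := by
  obtain ⟨p, hp⟩ := exists_eq_ciSup_of_finite (f := fun p => y p k)
  obtain ⟨q, hq⟩ := exists_eq_ciInf_of_finite (f := fun p => y p k)
  rw [spread, ← hp, ← hq]
  exact h p q

theorem spread_nonneg [Nonempty (Fin n)] (y : Fin n → Pos d) (k : Fin d) : 0 ≤ spread y k := by
  simpa using apply_sub_apply_le_spread y k (Classical.arbitrary _) (Classical.arbitrary _)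

theorem apply_mem_Icc_of_mem_convexHull {y : Fin n → Pos d} {v : Pos d}
    (hv : v ∈ convexHull ℝ (Set.range y)) (k : Fin d) :
    v k ∈ Set.Icc (⨅ p, y p k) (⨆ p, y p k) := by
  have hconv : Convex ℝ {v : Pos d | v k ∈ Set.Icc (⨅ p, y p k) (⨆ p, y p k)} :=
    (convex_Icc _ _).linear_preimage (EuclideanSpace.proj (𝕜 := ℝ) k).toLinearMap
  refine convexHull_min ?_ hconv hv
  rintro _ ⟨p, rfl⟩
  exact ⟨ciInf_le (Set.finite_range fun p => y p k).bddBelow p,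
    le_ciSup (Set.finite_range fun p => y p k).bddAbove p⟩

theorem abs_apply_sub_apply_le_spread {y : Fin n → Pos d} {v w : Pos d}
    (hv : v ∈ convexHull ℝ (Set.range y)) (hw : w ∈ convexHull ℝ (Set.range y)) (k : Fin d) :
    |v k - w k| ≤ spread y k := by
  have hv' := apply_mem_Icc_of_mem_convexHull hv k
  have hw' := apply_mem_Icc_of_mem_convexHull hw k
  exact abs_sub_le_of_le_of_le hv'.1 hv'.2 hw'.1 hw'.2

theorem isCompact_convexHull_of_subset_range {y : Fin n → Pos d} {S : Set (Pos d)}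
    (hS : S ⊆ Set.range y) : IsCompact (convexHull ℝ S) :=
  ((Set.finite_range y).subset hS).isCompact_convexHull ℝ

/-- Centroids of hulls of sets `S p` and `S q` that share a point differ, in each component, by at
most the fraction `d / (d + 1)` of the spread: the shared point keeps one centroid away from the
maximum and the other one away from the minimum. -/
theorem spread_centroid_le [Nonempty (Fin n)] {y : Fin n → Pos d} {S : Fin n → Set (Pos d)}
    (hS : ∀ p, S p ⊆ Set.range y) (hinter : ∀ p q, (S p ∩ S q).Nonempty) (k : Fin d) :
    spread (fun p => centroid (convexHull ℝ (S p))) k ≤ (d : ℝ) / (d + 1) * spread y k := by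
  refine spread_le fun p q => ?_
  obtain ⟨z, hzp, hzq⟩ := hinter p q
  have hsub : ∀ p, ∀ v ∈ convexHull ℝ (S p), v ∈ convexHull ℝ (Set.range y) :=
    fun p v hv => convexHull_mono (hS p) hv
  have h1 : centroid (convexHull ℝ (S p)) k - z k ≤
      (d : ℝ) / (d + 1) * ((⨆ p, y p k) - z k) := map_centroid_sub_le (convex_convexHull ℝ (S p))
    (isCompact_convexHull_of_subset_range (hS p)) (subset_convexHull ℝ _ hzp)
    (EuclideanSpace.proj (𝕜 := ℝ) k) (M := ⨆ p, y p k)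
    (fun v hv => (apply_mem_Icc_of_mem_convexHull (hsub p v hv) k).2)
  have h2 : -centroid (convexHull ℝ (S q)) k - -z k ≤
      (d : ℝ) / (d + 1) * (-(⨅ p, y p k) - -z k) := map_centroid_sub_le (convex_convexHull ℝ (S q))
    (isCompact_convexHull_of_subset_range (hS q)) (subset_convexHull ℝ _ hzq)
    (-EuclideanSpace.proj (𝕜 := ℝ) k) (M := -⨅ p, y p k)
    (fun v hv => neg_le_neg (apply_mem_Icc_of_mem_convexHull (hsub q v hv) k).1)
  rw [spread]
  linear_combination h1 + h2

theorem centroid_convexHull_mem {y : Fin n → Pos d} {S : Set (Pos d)}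
    (hS : S ⊆ Set.range y) (hne : S.Nonempty) :
    centroid (convexHull ℝ S) ∈ convexHull ℝ (Set.range y) :=
  convexHull_mono hS (centroid_mem (convex_convexHull ℝ S)
    (isCompact_convexHull_of_subset_range hS) hne.convexHull)

/-! ### Executions of the Amortized Centroid algorithm -/

/-- The set of positions that agent `p` has gathered `i` rounds after all agents have reset their
sets to `{y q}`, where `H i` is the graph of the `(i + 1)`-st of these rounds. -/
def gathered (H : ℕ → Digraph (Fin n)) (y : Fin n → Pos d) : ℕ → Fin n → Set (Pos d)
  | 0 => fun p => {y p}
  | i + 1 => fun p => gathered H y i p ∪ ⋃ q ∈ {q | (H i).Adj q p}, gathered H y i q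

theorem gathered_subset_range (H : ℕ → Digraph (Fin n)) (y : Fin n → Pos d) (i : ℕ) :
    ∀ p, gathered H y i p ⊆ Set.range y := by
  induction i with
  | zero =>
    intro p
    simp [gathered]
  | succ i ih => exact fun p => Set.union_subset (ih p) (Set.iUnion₂_subset fun q _ => ih q)

theorem subset_gathered_succ {H : ℕ → Digraph (Fin n)} {y : Fin n → Pos d} {i : ℕ} {p q : Fin n}
    (hqp : (H i).Adj q p) : gathered H y i q ⊆ gathered H y (i + 1) p :=
  fun _ hv => Or.inr (Set.mem_biUnion (x := q) hqp hv)

theorem gathered_inter_nonempty (hn : 2 ≤ n) (H : ℕ → Digraph (Fin n))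
    (hroot : ∀ i, IsRootedGraph (H i)) (hself : ∀ i p, (H i).Adj p p) (y : Fin n → Pos d)
    (p q : Fin n) : (gathered H y (n - 1) p ∩ gathered H y (n - 1) q).Nonempty := by
  obtain ⟨a, ha, b, hb, h⟩ := exists_inter_nonempty_of_card_lt H hroot hself (gathered H y)
    (fun p => Set.singleton_nonempty _)
    (fun i p q hqp => subset_gathered_succ hqp)
    (n - 1) {p} {q} (Finset.singleton_nonempty _) (Finset.singleton_nonempty _)
    (by simp only [Finset.card_singleton]; omega)
  rw [Finset.mem_singleton] at ha hb
  rwa [ha, hb] at h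

section Execution

variable {x₀ : Fin n → Pos d} {G : ℕ → Digraph (Fin n)}

/-- The states in an execution of the Amortized Centroid algorithm, as pairs of a position and a
set of gathered positions. -/
noncomputable def centroidRun (x₀ : Fin n → Pos d) (G : ℕ → Digraph (Fin n)) :
    ℕ → Fin n → Pos d × Set (Pos d) :=
  (amortizedCentroid n d).run x₀ G

theorem iUnion_received (C : Fin n → Pos d × Set (Pos d)) (H : Digraph (Fin n)) (p : Fin n) :
    ⋃ m ∈ {m : Fin n × (Pos d × Set (Pos d)) | H.Adj m.1 p ∧ m.2 = C m.1}, m.2.2 =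
      ⋃ q ∈ {q | H.Adj q p}, (C q).2 := by
  ext v
  simp only [Set.mem_iUnion, Set.mem_ofPred_eq, exists_prop, Prod.exists]
  constructor
  · rintro ⟨q, c, s, ⟨hq, h⟩, hv⟩
    exact ⟨q, hq, h ▸ hv⟩
  · rintro ⟨q, hq, hv⟩
    exact ⟨q, _, _, ⟨hq, rfl⟩, hv⟩

theorem centroidRun_succ_of_not_modEq {t : ℕ} (ht : ¬ t + 1 ≡ 0 [MOD (n - 1)]) (p : Fin n) :
    centroidRun x₀ G (t + 1) p = ((centroidRun x₀ G t p).1, (centroidRun x₀ G t p).2 ∪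
      ⋃ q ∈ {q | (G (t + 1)).Adj q p}, (centroidRun x₀ G t q).2) := by
  rw [← iUnion_received]
  exact if_neg ht

theorem centroidRun_succ_of_modEq {t : ℕ} (ht : t + 1 ≡ 0 [MOD (n - 1)]) (p : Fin n) :
    centroidRun x₀ G (t + 1) p = (fun c => (c, {c}))
      (centroid (convexHull ℝ ((centroidRun x₀ G t p).2 ∪
        ⋃ q ∈ {q | (G (t + 1)).Adj q p}, (centroidRun x₀ G t q).2))) := by
  rw [← iUnion_received]
  exact if_pos ht

theorem x_apply (t : ℕ) (p : Fin n) :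
    (amortizedCentroid n d).x x₀ G t p = (centroidRun x₀ G t p).1 :=
  rfl

theorem x_zero : (amortizedCentroid n d).x x₀ G 0 = x₀ :=
  rfl

/-- Between two resets, agents keep their positions and only gather. -/
theorem centroidRun_mul_add (j : ℕ) {y : Fin n → Pos d}
    (hy : ∀ p, centroidRun x₀ G ((n - 1) * j) p = (y p, {y p})) (i : ℕ)
    (hi : i < n - 1) (p : Fin n) :
    centroidRun x₀ G ((n - 1) * j + i) p =
      (y p, gathered (fun i => G ((n - 1) * j + i + 1)) y i p) := by
  induction i generalizing p with
  | zero => exact hy p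
  | succ i ih =>
    have hmod : ¬ (n - 1) * j + i + 1 ≡ 0 [MOD (n - 1)] := by
      rw [Nat.modEq_zero_iff_dvd, add_assoc, Nat.dvd_add_right (dvd_mul_right _ _)]
      exact fun h => absurd (Nat.le_of_dvd i.succ_pos h) (by omega)
    rw [← add_assoc, centroidRun_succ_of_not_modEq hmod]
    simp_rw [ih (by omega)]
    rfl

/-- The reset replaces every position by the centroid of the hull of all that was gathered in the
`n - 1` rounds before, the round of the reset included. -/
theorem centroidRun_mul_succ (hn : 2 ≤ n) (j : ℕ) {y : Fin n → Pos d}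
    (hy : ∀ p, centroidRun x₀ G ((n - 1) * j) p = (y p, {y p})) (p : Fin n) :
    centroidRun x₀ G ((n - 1) * (j + 1)) p = (fun c => (c, {c}))
      (centroid (convexHull ℝ (gathered (fun i => G ((n - 1) * j + i + 1)) y (n - 1) p))) := by
  obtain ⟨m, hm⟩ : ∃ m, n - 1 = m + 1 := ⟨n - 2, by omega⟩
  have hmul : (n - 1) * (j + 1) = (n - 1) * j + m + 1 := by rw [mul_add_one]; omega
  have hmod : (n - 1) * j + m + 1 ≡ 0 [MOD (n - 1)] := by
    rw [Nat.modEq_zero_iff_dvd, ← hmul]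
    exact dvd_mul_right _ _
  rw [hmul, centroidRun_succ_of_modEq hmod]
  simp_rw [centroidRun_mul_add j hy m (by omega)]
  have hg := congrArg (fun i => gathered (fun i => G ((n - 1) * j + i + 1)) y i p) hm
  exact congrArg (fun S => (fun c : Pos d => (c, ({c} : Set (Pos d)))) (centroid (convexHull ℝ S)))
    hg.symm

theorem centroidRun_mul (hn : 2 ≤ n) (j : ℕ) (p : Fin n) :
    centroidRun x₀ G ((n - 1) * j) p =
      ((amortizedCentroid n d).x x₀ G ((n - 1) * j) p,
        {(amortizedCentroid n d).x x₀ G ((n - 1) * j) p}) := by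
  induction j generalizing p with
  | zero => rfl
  | succ j ih =>
    have h := centroidRun_mul_succ hn j ih p
    rw [x_apply, h]

theorem x_mul_succ (hn : 2 ≤ n) (j : ℕ) :
    (amortizedCentroid n d).x x₀ G ((n - 1) * (j + 1)) = fun p =>
      centroid (convexHull ℝ (gathered (fun i => G ((n - 1) * j + i + 1))
        ((amortizedCentroid n d).x x₀ G ((n - 1) * j)) (n - 1) p)) := by
  funext p
  rw [x_apply, centroidRun_mul_succ hn j (centroidRun_mul hn j) p]

theorem x_eq_x_mul_div (hn : 2 ≤ n) (t : ℕ) :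
    (amortizedCentroid n d).x x₀ G t =
      (amortizedCentroid n d).x x₀ G ((n - 1) * (t / (n - 1))) := by
  funext p
  have h := centroidRun_mul_add (t / (n - 1)) (centroidRun_mul (x₀ := x₀) (G := G) hn _) (t % (n - 1))
    (Nat.mod_lt _ (by omega)) p
  rw [Nat.div_add_mod] at h
  rw [x_apply, h]

theorem x_eq_of_eq_one (hn : n = 1) (t : ℕ) : (amortizedCentroid n d).x x₀ G t = x₀ := by
  induction t with
  | zero => rfl
  | succ t ih =>
    funext p
    -- modulo `n - 1 = 0`, only `0` is congruent to `0`, so that the agent never moves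
    have hmod : ¬ t + 1 ≡ 0 [MOD (n - 1)] := by
      subst hn
      simp [Nat.modEq_zero_iff_dvd]
    rw [x_apply, centroidRun_succ_of_not_modEq hmod]
    exact congrFun ih p

variable {N : NetworkModel n}

theorem convexHull_range_x_succ_subset (hn : 2 ≤ n) (hN : N.IsRooted) (hG : N.IsPattern G)
    (j : ℕ) :
    convexHull ℝ (Set.range ((amortizedCentroid n d).x x₀ G ((n - 1) * (j + 1)))) ⊆
      convexHull ℝ (Set.range ((amortizedCentroid n d).x x₀ G ((n - 1) * j))) := by
  refine convexHull_min ?_ (convex_convexHull ℝ _)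
  rw [x_mul_succ hn]
  rintro _ ⟨p, rfl⟩
  have h := gathered_inter_nonempty hn (fun i => G ((n - 1) * j + i + 1)) (fun i => hN _ (hG _))
    (fun i => N.selfLoop _ (hG _)) ((amortizedCentroid n d).x x₀ G ((n - 1) * j)) p p
  exact centroid_convexHull_mem (gathered_subset_range _ _ _ _) (by simpa using h)

theorem spread_x_mul_le (hn : 2 ≤ n) (hN : N.IsRooted) (hG : N.IsPattern G) (j : ℕ)
    (k : Fin d) :
    spread ((amortizedCentroid n d).x x₀ G ((n - 1) * j)) k ≤
      ((d : ℝ) / (d + 1)) ^ j * spread x₀ k := by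
  have : Nonempty (Fin n) := ⟨⟨0, by omega⟩⟩
  induction j with
  | zero => simp [x_zero]
  | succ j ih =>
    rw [x_mul_succ hn, pow_succ', mul_assoc]
    refine (spread_centroid_le (gathered_subset_range _ _ _) (gathered_inter_nonempty hn _
      (fun i => hN _ (hG _)) (fun i => N.selfLoop _ (hG _)) _) k).trans ?_
    gcongr

theorem div_add_one_lt_one (d : ℕ) : (d : ℝ) / (d + 1) < 1 := by
  rw [div_lt_one (by positivity)]
  linarith

/-- The spread decreases by the factor `d / (d + 1)` in every `n - 1` rounds. -/
theorem spread_x_le (hN : N.IsRooted) (hG : N.IsPattern G) {t j : ℕ} (hj : (n - 1) * j ≤ t)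
    (k : Fin d) :
    spread ((amortizedCentroid n d).x x₀ G t) k ≤ ((d : ℝ) / (d + 1)) ^ j * spread x₀ k := by
  obtain ⟨r, -⟩ := hN _ (hG 0)
  have : Nonempty (Fin n) := ⟨r⟩
  have hn1 := r.pos
  rcases Nat.lt_or_ge n 2 with hn | hn
  · rw [x_eq_of_eq_one (by omega)]
    have h0 : spread x₀ k = 0 := by
      refine le_antisymm (spread_le fun p q => ?_) (spread_nonneg x₀ k)
      have : p = q := by ext; omega
      simp [this]
    simp [h0]
  · rw [x_eq_x_mul_div hn]
    refine (spread_x_mul_le hn hN hG _ k).trans ?_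
    refine mul_le_mul_of_nonneg_right ?_ (spread_nonneg x₀ k)
    refine pow_le_pow_of_le_one (by positivity) (div_add_one_lt_one d).le ?_
    rw [Nat.le_div_iff_mul_le (by omega)]
    linarith

/-- A point in the intersection of the nested hulls is approached at the rate at which the
spreads decrease. -/
theorem exists_abs_x_sub_le (hN : N.IsRooted) (hG : N.IsPattern G) :
    ∃ l ∈ convexHull ℝ (Set.range x₀), ∀ t j p k, (n - 1) * j ≤ t →
      |(amortizedCentroid n d).x x₀ G t p k - l k| ≤ ((d : ℝ) / (d + 1)) ^ j * spread x₀ k := by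
  obtain ⟨r, -⟩ := hN _ (hG 0)
  have : Nonempty (Fin n) := ⟨r⟩
  have hn1 := r.pos
  rcases Nat.lt_or_ge n 2 with hn | hn
  · refine ⟨x₀ r, subset_convexHull ℝ _ ⟨r, rfl⟩, fun t j p k _ => ?_⟩
    have hp : p = r := by ext; omega
    rw [x_eq_of_eq_one (by omega), hp, sub_self, abs_zero]
    exact mul_nonneg (by positivity) (spread_nonneg x₀ k)
  · have hcomp : ∀ j, IsCompact
        (convexHull ℝ (Set.range ((amortizedCentroid n d).x x₀ G ((n - 1) * j)))) :=
      fun j => isCompact_convexHull_of_subset_range subset_rfl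
    obtain ⟨l, hl⟩ := IsCompact.nonempty_iInter_of_sequence_nonempty_isCompact_isClosed
      (fun j => convexHull ℝ (Set.range ((amortizedCentroid n d).x x₀ G ((n - 1) * j))))
      (convexHull_range_x_succ_subset hn hN hG) (fun j => (Set.range_nonempty _).convexHull)
      (hcomp 0) (fun j => (hcomp j).isClosed)
    rw [Set.mem_iInter] at hl
    refine ⟨l, by simpa [x_zero] using hl 0, fun t j p k hj => ?_⟩
    refine le_trans ?_ (spread_x_le hN hG hj k)
    rw [x_eq_x_mul_div hn]
    exact abs_apply_sub_apply_le_spread (subset_convexHull ℝ _ ⟨p, rfl⟩) (hl _) k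

end Execution

/-! ### Convergence rate and convergence time -/

theorem norm_le_sum_abs (v : Pos d) : ‖v‖ ≤ ∑ k, |v k| := by
  rw [EuclideanSpace.norm_eq, Real.sqrt_le_left (Finset.sum_nonneg fun k _ => abs_nonneg _)]
  simp only [Real.norm_eq_abs]
  exact Finset.sum_sq_le_sq_sum_of_nonneg fun _ _ => abs_nonneg _

theorem exists_norm_x_sub_le {x₀ : Fin n → Pos d} {G : ℕ → Digraph (Fin n)} {N : NetworkModel n}
    (hN : N.IsRooted) (hG : N.IsPattern G) :
    ∃ l ∈ convexHull ℝ (Set.range x₀), ∃ A > 0, ∀ t p,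
      ‖(amortizedCentroid n d).x x₀ G t p - l‖ ≤ A * ((d : ℝ) / (d + 1)) ^ (t / n) := by
  obtain ⟨r, -⟩ := hN _ (hG 0)
  have : Nonempty (Fin n) := ⟨r⟩
  obtain ⟨l, hl, h⟩ := exists_abs_x_sub_le (x₀ := x₀) hN hG
  have hs : 0 ≤ ∑ k, spread x₀ k := Finset.sum_nonneg fun k _ => spread_nonneg x₀ k
  refine ⟨l, hl, ∑ k, spread x₀ k + 1, by linarith, fun t p => ?_⟩
  calc ‖(amortizedCentroid n d).x x₀ G t p - l‖
      ≤ ∑ k, |(amortizedCentroid n d).x x₀ G t p k - l k| := norm_le_sum_abs _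
    _ ≤ ∑ k, ((d : ℝ) / (d + 1)) ^ (t / n) * spread x₀ k := by
        refine Finset.sum_le_sum fun k _ => h t (t / n) p k ?_
        exact (Nat.mul_le_mul_right _ (Nat.sub_le n 1)).trans (Nat.mul_div_le t n)
    _ ≤ (∑ k, spread x₀ k + 1) * ((d : ℝ) / (d + 1)) ^ (t / n) := by
        rw [← Finset.mul_sum, mul_comm]
        gcongr
        linarith

/-- A sequence of norms bounded by `A * c ^ ⌊t / n⌋` decreases at the rate `c ^ (1 / n)`. -/
theorem limsup_enorm_rpow_le {E : Type*} [NormedAddCommGroup E] {u : ℕ → E} {A c : ℝ} {n : ℕ}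
    (hA : 0 < A) (hc0 : 0 < c) (hc1 : c ≤ 1) (hn : 0 < n)
    (hu : ∀ t, ‖u t‖ ≤ A * c ^ (t / n)) :
    limsup (fun t : ℕ => ‖u t‖ₑ ^ (1 / (t : ℝ))) atTop ≤ ENNReal.ofReal (c ^ (1 / (n : ℝ))) := by
  have hn' : (0 : ℝ) < n := by exact_mod_cast hn
  have hbound : ∀ t : ℕ, 0 < t →
      ‖u t‖ ^ (1 / (t : ℝ)) ≤ (A / c) ^ (1 / (t : ℝ)) * c ^ (1 / (n : ℝ)) := by
    intro t ht
    have ht' : (0 : ℝ) < t := by exact_mod_cast ht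
    have hfloor : c ^ (t / n) ≤ c ^ ((t : ℝ) / n - 1) := by
      rw [← Real.rpow_natCast]
      refine Real.rpow_le_rpow_of_exponent_ge hc0 hc1 ?_
      rw [sub_le_iff_le_add, div_le_iff₀ hn']
      exact_mod_cast (Nat.lt_div_mul_add (a := t) hn).le.trans_eq (by ring)
    calc ‖u t‖ ^ (1 / (t : ℝ)) ≤ (A / c * c ^ ((t : ℝ) / n)) ^ (1 / (t : ℝ)) := by
          refine Real.rpow_le_rpow (norm_nonneg _) ?_ (by positivity)
          refine (hu t).trans ((mul_le_mul_of_nonneg_left hfloor hA.le).trans_eq ?_)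
          rw [Real.rpow_sub_one hc0.ne']
          ring
      _ = (A / c) ^ (1 / (t : ℝ)) * c ^ (1 / (n : ℝ)) := by
          rw [Real.mul_rpow (by positivity) (by positivity), ← Real.rpow_mul hc0.le]
          congr 2
          field_simp
  have hlim : Tendsto (fun t : ℕ => (A / c) ^ (1 / (t : ℝ)) * c ^ (1 / (n : ℝ))) atTop
      (𝓝 (c ^ (1 / (n : ℝ)))) := by
    have h1 : Tendsto (fun t : ℕ => (A / c) ^ (1 / (t : ℝ))) atTop (𝓝 ((A / c) ^ (0 : ℝ))) :=
      (Real.continuousAt_const_rpow (by positivity)).tendsto.comp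
        tendsto_one_div_atTop_nhds_zero_nat
    simpa using h1.mul_const (c ^ (1 / (n : ℝ)))
  rw [← (ENNReal.tendsto_ofReal hlim).limsup_eq]
  refine limsup_le_limsup ?_
  filter_upwards [eventually_gt_atTop 0] with t ht
  rw [← ofReal_norm, ENNReal.ofReal_rpow_of_nonneg (norm_nonneg _) (by positivity)]
  exact ENNReal.ofReal_le_ofReal (hbound t ht)

/-- Bernoulli's inequality for the factor `d / (d + 1)`. -/
theorem div_add_one_rpow_one_div_le {n : ℕ} (d : ℕ) (hn : 1 ≤ n) :
    ((d : ℝ) / (d + 1)) ^ (1 / (n : ℝ)) ≤ 1 - 1 / ((n : ℝ) * ((d : ℝ) + 1)) := by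
  have hn' : (1 : ℝ) ≤ n := by exact_mod_cast hn
  have hd : (0 : ℝ) < (d : ℝ) + 1 := by positivity
  have h := rpow_one_add_le_one_add_mul_self (s := -(1 / ((d : ℝ) + 1))) (p := 1 / (n : ℝ))
    (by rw [neg_le_neg_iff, div_le_one hd]; linarith) (by positivity)
    (by rw [div_le_one (by linarith)]; exact hn')
  have h1 : 1 + -(1 / ((d : ℝ) + 1)) = (d : ℝ) / (d + 1) := by field_simp; ring
  rw [h1] at h
  refine h.trans_eq ?_
  field_simp
  ring

theorem pow_ceil_logb_mul_le (hd : 1 ≤ d) {s ε : ℝ} (hs : 0 ≤ s) (hε : 0 < ε) :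
    ((d : ℝ) / (d + 1)) ^ ⌈Real.logb (((d : ℝ) + 1) / d) (s / ε)⌉₊ * s ≤ ε := by
  have hd' : (0 : ℝ) < d := by exact_mod_cast hd
  rcases hs.eq_or_lt with rfl | hs
  · simpa using hε.le
  have hb : 1 < ((d : ℝ) + 1) / d := by
    rw [one_lt_div hd']
    linarith
  have h := Nat.le_ceil (Real.logb (((d : ℝ) + 1) / d) (s / ε))
  rw [Real.logb_le_iff_le_rpow hb (by positivity), Real.rpow_natCast, div_le_iff₀ hε] at h
  rw [← inv_div ((d : ℝ) + 1), inv_pow, inv_mul_le_iff₀ (by positivity)]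
  exact h

/-- The two notions of convergence time are instances of the least time from which on the spreads
of the components meet prescribed bounds. -/
theorem iSup_iInf_le_of_forall_spread_le {x : ℕ → Fin n → Pos d} {b : Fin d → ℝ} {T : ℕ}
    (h : ∀ t ≥ T, ∀ k, spread (x t) k ≤ b k) :
    ⨆ k : Fin d, ⨅ (τ : ℕ) (_ : ∀ t ≥ τ, spread (x t) k ≤ b k), (τ : ℕ∞) ≤ T :=
  iSup_le fun k => iInf₂_le T fun t ht => h t ht k

end AsymptoticConsensus

theorem theorem5 {n d : ℕ} (hd : 1 ≤ d) (N : AsymptoticConsensus.NetworkModel n)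
    (hN : N.IsRooted) :
    (AsymptoticConsensus.amortizedCentroid n d).SolvesAsymptoticConsensus N ∧
    (AsymptoticConsensus.amortizedCentroid n d).convergenceRate N ≤
      ENNReal.ofReal (1 - 1 / ((n : ℝ) * ((d : ℝ) + 1))) ∧
    ∀ (x₀ : Fin n → AsymptoticConsensus.Pos d) (G : ℕ → Digraph (Fin n)), N.IsPattern G →
      ∀ ε : ℝ, 0 < ε →
        AsymptoticConsensus.convergenceTime
            ((AsymptoticConsensus.amortizedCentroid n d).x x₀ G) ε ≤
          (((n - 1) * ⌈Real.logb (((d : ℝ) + 1) / d)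
            ((⨆ k, AsymptoticConsensus.spread x₀ k) / ε)⌉₊ : ℕ) : ℕ∞) ∧
        AsymptoticConsensus.relConvergenceTime
            ((AsymptoticConsensus.amortizedCentroid n d).x x₀ G) ε ≤
          (((n - 1) * ⌈Real.logb (((d : ℝ) + 1) / d) (1 / ε)⌉₊ : ℕ) : ℕ∞) := by
  open AsymptoticConsensus in
  obtain ⟨r, -⟩ := hN _ N.nonempty.some_mem
  have : Nonempty (Fin n) := ⟨r⟩
  have hn : 0 < n := r.pos
  have hd' : (0 : ℝ) < d := by exact_mod_cast hd
  have hc0 : 0 < (d : ℝ) / (d + 1) := by positivity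
  have hlim : ∀ (x₀ : Fin n → Pos d) (G : ℕ → Digraph (Fin n)) (l : Pos d) (A : ℝ),
      (∀ t p, ‖(amortizedCentroid n d).x x₀ G t p - l‖ ≤ A * ((d : ℝ) / (d + 1)) ^ (t / n)) →
      ∀ p, Tendsto (fun t => (amortizedCentroid n d).x x₀ G t p) atTop (𝓝 l) := by
    intro x₀ G l A h p
    rw [tendsto_iff_norm_sub_tendsto_zero]
    refine squeeze_zero (fun _ => norm_nonneg _) (fun t => h t p) ?_
    simpa using ((tendsto_pow_atTop_nhds_zero_of_lt_one hc0.le (div_add_one_lt_one d)).comp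
      (Nat.tendsto_div_const_atTop hn.ne')).const_mul A
  refine ⟨fun x₀ G hG => ?_, ?_, fun x₀ G hG ε hε => ⟨?_, ?_⟩⟩
  · obtain ⟨l, hl, A, -, h⟩ := exists_norm_x_sub_le (x₀ := x₀) hN hG
    have ht := hlim x₀ G l A h
    refine ⟨fun p => ⟨l, ht p⟩, fun p q l₁ l₂ h₁ h₂ => ?_, fun p l₁ h₁ => ?_⟩
    · rw [tendsto_nhds_unique h₁ (ht p), tendsto_nhds_unique h₂ (ht q)]
    · rwa [tendsto_nhds_unique h₁ (ht p)]
  · refine iSup_le fun x₀ => iSup_le fun G => iSup_le fun hG => iSup_le fun l => iSup_le fun hl =>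
      iSup_le fun p => ?_
    obtain ⟨l', -, A, hA, h⟩ := exists_norm_x_sub_le (x₀ := x₀) hN hG
    rw [tendsto_nhds_unique (hl p) (hlim x₀ G l' A h p)]
    exact (limsup_enorm_rpow_le hA hc0 (div_add_one_lt_one d).le hn fun t => h t p).trans
      (ENNReal.ofReal_le_ofReal (div_add_one_rpow_one_div_le d hn))
  · refine iSup_iInf_le_of_forall_spread_le fun t ht k => ?_
    have hk : spread x₀ k ≤ ⨆ k, spread x₀ k := le_ciSup (Set.finite_range _).bddAbove k
    refine (spread_x_le hN hG ht k).trans ?_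
    refine (mul_le_mul_of_nonneg_left hk (by positivity)).trans ?_
    exact pow_ceil_logb_mul_le hd ((spread_nonneg x₀ k).trans hk) hε
  · refine iSup_iInf_le_of_forall_spread_le fun t ht k => ?_
    refine (spread_x_le hN hG ht k).trans ?_
    refine mul_le_mul_of_nonneg_right ?_ (spread_nonneg x₀ k)
    simpa using pow_ceil_logb_mul_le hd zero_le_one hε
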